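/- Let $[n]=\{1,\dots,n\}$ with its usual order; an interval of $[n]$ is a nonempty set of consecutive elements. For a graph $H=([n],E)$ and nonempty $C,D\subseteq[n]$ let $d(C,D)=e(C,D)/(|C||D|)$, where $e(C,D)$ is the number of pairs $(u,v)\in C\times D$ with $u$ and $v$ adjacent in $H$. For each $\varepsilon>0$ and $p\in\mathbb{N}$ there exists $k_{p,\varepsilon}\in\mathbb{N}$ such that for each $n\ge 1$, each (finite simple) graph $H=([n],E)$ and each partition $P$ of $[n]$ into intervals with $|P|\le p$, $P$ has a refinement to a partition $Q$ of $[n]$ into at most $k_{p,\varepsilon}$ intervals such that all intervals in $Q$ have the same size, except for some of them that together cover at most $\varepsilon n$ vertices, and such that $$\sum_{A,B\in Q}\ \max_{\substack{I\subseteq A,\ J\subseteq B\\ I,J\text{ intervals}}}|I||J|\,|d(I,J)-d(A,B)|<\varepsilon n^2 ,$$ where the sum ranges over all ordered pairs $(A,B)\in Q\times Q$, including $A=B$. -/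

import Mathlib

/-- `I` is a (nonempty) interval of the linearly ordered vertex set `Fin n`. -/
def IsVertexInterval {n : ℕ} (I : Finset (Fin n)) : Prop :=
  I.Nonempty ∧ (I : Set (Fin n)).OrdConnected

/-- A partition of `Fin n` all of whose classes are intervals. -/
def IsIntervalPartition {n : ℕ} (P : Finpartition (Finset.univ : Finset (Fin n))) : Prop :=
  ∀ A ∈ P.parts, IsVertexInterval A

/-- All classes of the partition have the same cardinality, except for some classes that together
cover at most `ε * n` elements. -/
def IsEpsBalanced {n : ℕ} (ε : ℝ) (Q : Finpartition (Finset.univ : Finset (Fin n))) : Prop :=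
  ∃ E : Finset (Finset (Fin n)), E ⊆ Q.parts ∧
    (∀ A ∈ Q.parts \ E, ∀ B ∈ Q.parts \ E, A.card = B.card) ∧
    ((E.biUnion id).card : ℝ) ≤ ε * n

/-- The values `|I| |J| |d(I,J) - d(A,B)|`, for intervals `I ⊆ A` and `J ⊆ B`. Here
`d(I,J) = e(I,J) / (|I| |J|)`, with `e(I,J)` the number of pairs in `I × J` that are adjacent. -/
def intervalDeviations {n : ℕ} (G : SimpleGraph (Fin n)) [DecidableRel G.Adj]
    (A B : Finset (Fin n)) : Set ℝ :=
  {x | ∃ I J : Finset (Fin n), I ⊆ A ∧ J ⊆ B ∧ IsVertexInterval I ∧ IsVertexInterval J ∧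
    x = (I.card : ℝ) * (J.card : ℝ) *
      |(G.edgeDensity I J : ℝ) - (G.edgeDensity A B : ℝ)|}

/-- The maximum of `|I| |J| |d(I,J) - d(A,B)|` over intervals `I ⊆ A` and `J ⊆ B`. -/
noncomputable def maxIntervalDeviation {n : ℕ} (G : SimpleGraph (Fin n)) [DecidableRel G.Adj]
    (A B : Finset (Fin n)) : ℝ :=
  sSup (intervalDeviations G A B)

/-- For nonempty `A` and `B` the supremum is a genuine maximum. -/
theorem isGreatest_maxIntervalDeviation {n : ℕ} (G : SimpleGraph (Fin n)) [DecidableRel G.Adj]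
    {A B : Finset (Fin n)} (hA : A.Nonempty) (hB : B.Nonempty) :
    IsGreatest (intervalDeviations G A B) (maxIntervalDeviation G A B) := by
  have hfin : (intervalDeviations G A B).Finite := by
    refine (Set.finite_range (fun q : Finset (Fin n) × Finset (Fin n) =>
      (q.1.card : ℝ) * (q.2.card : ℝ) *
        |(G.edgeDensity q.1 q.2 : ℝ) - (G.edgeDensity A B : ℝ)|)).subset ?_
    rintro x ⟨I, J, -, -, -, -, rfl⟩
    exact ⟨(I, J), rfl⟩
  have hne : (intervalDeviations G A B).Nonempty := by
    obtain ⟨a, ha⟩ := hA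
    obtain ⟨b, hb⟩ := hB
    refine ⟨_, {a}, {b}, by simpa using ha, by simpa using hb, ⟨by simp, ?_⟩, ⟨by simp, ?_⟩, rfl⟩
    · rw [Finset.coe_singleton]; exact Set.ordConnected_singleton
    · rw [Finset.coe_singleton]; exact Set.ordConnected_singleton
  exact ⟨hne.csSup_mem hfin, fun x hx => le_csSup hfin.bddAbove hx⟩

/-! Average the adjacency indicator over products of classes. The energy of a partition, the sum of
the squares of this step function, lies between 0 and n² and does not decrease under refinement.
Chop the classes of P repeatedly, each time into pieces much shorter than n divided by the current
number of classes. Some step, from Q to Q', raises the energy little; by Pythagoras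
(`sum_sq_stepFunction_sub`) the step functions of Q and Q' are then close in L¹.

An interval is a union of classes of Q' except near its two ends. So for intervals I ⊆ A and J ⊆ B
the edge count on I × J agrees with the sum of the Q' step function up to a small boundary error,
and passing to the Q step function costs at most the L¹ distance on A × B. This bound does not
depend on I and J, so one Q' serves all of them, and the bounds add up over all pairs
(`sum_maxIntervalDeviation_le`). Balance holds because chopping leaves at most one short piece per
class. -/

open Finset

/-! ### Step functions, energy and L¹ estimates -/

section StepFunction

variable {α : Type*}

/-- The average of `F` over `A × B`. -/
noncomputable def blockDensity (F : α → α → ℝ) (A B : Finset α) : ℝ :=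
  (∑ u ∈ A, ∑ v ∈ B, F u v) / (#A * #B)

theorem blockDensity_nonneg {F : α → α → ℝ} (h0 : ∀ u v, 0 ≤ F u v) (A B : Finset α) :
    0 ≤ blockDensity F A B :=
  div_nonneg (sum_nonneg fun _ _ => sum_nonneg fun _ _ => h0 _ _) (by positivity)

theorem blockDensity_le_one {F : α → α → ℝ} (h1 : ∀ u v, F u v ≤ 1) (A B : Finset α) :
    blockDensity F A B ≤ 1 := by
  refine div_le_one_of_le₀ ?_ (by positivity)
  calc ∑ u ∈ A, ∑ v ∈ B, F u v ≤ ∑ u ∈ A, ∑ v ∈ B, (1 : ℝ) :=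
        sum_le_sum fun _ _ => sum_le_sum fun _ _ => h1 _ _
    _ = #A * #B := by simp

theorem card_mul_blockDensity (F : α → α → ℝ) {A B : Finset α} (hA : A.Nonempty)
    (hB : B.Nonempty) : #A * #B * blockDensity F A B = ∑ u ∈ A, ∑ v ∈ B, F u v := by
  have hA' : (#A : ℝ) ≠ 0 := by exact_mod_cast hA.card_pos.ne'
  have hB' : (#B : ℝ) ≠ 0 := by exact_mod_cast hB.card_pos.ne'
  rw [blockDensity]
  field_simp

variable [Fintype α] [DecidableEq α]

/-- The step function which averages `F` over products of classes of `Q`. -/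
noncomputable def stepFunction (Q : Finpartition (univ : Finset α)) (F : α → α → ℝ) (u v : α) : ℝ :=
  blockDensity F (Q.part u) (Q.part v)

/-- The sum of the squares of the step function. -/
noncomputable def stepEnergy (Q : Finpartition (univ : Finset α)) (F : α → α → ℝ) : ℝ :=
  ∑ u, ∑ v, stepFunction Q F u v ^ 2

theorem Finpartition.sum_parts_sum (Q : Finpartition (univ : Finset α)) (g : α → ℝ) :
    ∑ A ∈ Q.parts, ∑ u ∈ A, g u = ∑ u, g u := by
  have h := sum_biUnion (f := g) Q.disjoint
  rw [Q.biUnion_parts] at h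
  exact h.symm

theorem Finpartition.sum_parts_sum_sum (Q : Finpartition (univ : Finset α)) (g : α → α → ℝ) :
    ∑ A ∈ Q.parts, ∑ B ∈ Q.parts, ∑ u ∈ A, ∑ v ∈ B, g u v = ∑ u, ∑ v, g u v := by
  rw [← Q.sum_parts_sum]
  refine sum_congr rfl fun A _ => ?_
  rw [sum_comm]
  exact sum_congr rfl fun u _ => Q.sum_parts_sum _

theorem Finpartition.sum_parts_card (Q : Finpartition (univ : Finset α)) :
    ∑ A ∈ Q.parts, (#A : ℝ) = Fintype.card α := by
  have := Q.sum_card_parts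
  rw [← Nat.cast_sum, this, card_univ]

theorem Finpartition.mem_part_comm (Q : Finpartition (univ : Finset α)) {u v : α} :
    u ∈ Q.part v ↔ v ∈ Q.part u := by
  rw [Q.mem_part_iff_part_eq_part (mem_univ _) (mem_univ _),
    Q.mem_part_iff_part_eq_part (mem_univ _) (mem_univ _), eq_comm]

theorem Finpartition.part_eq_part (Q : Finpartition (univ : Finset α)) {u v : α}
    (h : u ∈ Q.part v) : Q.part u = Q.part v :=
  (Q.mem_part_iff_part_eq_part (mem_univ _) (mem_univ _)).1 h

/-- Averaging over the classes of a partition preserves sums over unions of classes. -/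
theorem Finpartition.sum_average_part (Q : Finpartition (univ : Finset α)) (g : α → ℝ)
    {S : Finset α} (hS : ∀ u ∈ S, Q.part u ⊆ S) :
    ∑ u ∈ S, (∑ w ∈ Q.part u, g w) / #(Q.part u) = ∑ u ∈ S, g u := by
  simp_rw [sum_div]
  rw [sum_comm' (t' := S) (s' := fun w => Q.part w)]
  · refine sum_congr rfl fun w _ => ?_
    have h : ∀ u ∈ Q.part w, g w / #(Q.part u) = g w / #(Q.part w) := fun u hu => by
      rw [Q.part_eq_part hu]
    rw [sum_congr rfl h, sum_const, nsmul_eq_mul]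
    have : (#(Q.part w) : ℝ) ≠ 0 := by
      simp
    field_simp
  · intro u w
    constructor
    · rintro ⟨hu, hw⟩
      exact ⟨Q.mem_part_comm.1 hw, hS u hu hw⟩
    · rintro ⟨hu, hw⟩
      exact ⟨hS w hw hu, Q.mem_part_comm.1 hu⟩

theorem sum_stepFunction (Q : Finpartition (univ : Finset α)) (F : α → α → ℝ)
    {S T : Finset α} (hS : ∀ u ∈ S, Q.part u ⊆ S) (hT : ∀ u ∈ T, Q.part u ⊆ T) :
    ∑ u ∈ S, ∑ v ∈ T, stepFunction Q F u v = ∑ u ∈ S, ∑ v ∈ T, F u v := by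
  rw [← Q.sum_average_part (fun u => ∑ v ∈ T, F u v) hS]
  refine sum_congr rfl fun u _ => ?_
  rw [sum_comm, ← Q.sum_average_part (fun v => ∑ w ∈ Q.part u, F w v) hT, sum_div]
  refine sum_congr rfl fun v _ => ?_
  rw [stepFunction, blockDensity, sum_comm, div_div, mul_comm]

theorem stepFunction_eq (Q : Finpartition (univ : Finset α)) (F : α → α → ℝ) {A B : Finset α}
    (hA : A ∈ Q.parts) (hB : B ∈ Q.parts) {u v : α} (hu : u ∈ A) (hv : v ∈ B) :
    stepFunction Q F u v = blockDensity F A B := by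
  rw [stepFunction, Q.part_eq_of_mem hA hu, Q.part_eq_of_mem hB hv]

theorem Finpartition.part_subset_of_le {Q Q' : Finpartition (univ : Finset α)} (h : Q' ≤ Q)
    {A : Finset α} (hA : A ∈ Q.parts) {u : α} (hu : u ∈ A) : Q'.part u ⊆ A := by
  obtain ⟨B, hB, hsub⟩ := h (Q'.part_mem.2 (mem_univ u))
  have huB : u ∈ B := hsub (Q'.mem_part (mem_univ u))
  rwa [← Q.part_eq_of_mem hA hu, Q.part_eq_of_mem hB huB]

/-- Pythagoras' theorem for the step functions of a partition and a refinement of it. -/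
theorem sum_sq_stepFunction_sub {Q Q' : Finpartition (univ : Finset α)} (h : Q' ≤ Q)
    (F : α → α → ℝ) :
    ∑ u, ∑ v, (stepFunction Q' F u v - stepFunction Q F u v) ^ 2 =
      stepEnergy Q' F - stepEnergy Q F := by
  rw [stepEnergy, stepEnergy, ← Q.sum_parts_sum_sum, ← Q.sum_parts_sum_sum (fun u v => _ ^ 2),
    ← Q.sum_parts_sum_sum (fun u v => stepFunction Q F u v ^ 2)]
  simp_rw [← sum_sub_distrib]
  refine sum_congr rfl fun A hA => sum_congr rfl fun B hB => ?_
  set d := blockDensity F A B with hd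
  have hcell : ∀ C ∈ Q.parts, ∀ u ∈ C, Q.part u ⊆ C := fun C hC u hu =>
    (Q.part_eq_of_mem hC hu).subset
  have h1 : ∑ u ∈ A, ∑ v ∈ B, stepFunction Q' F u v = ∑ u ∈ A, ∑ v ∈ B, stepFunction Q F u v := by
    rw [sum_stepFunction Q' F (fun _ => Finpartition.part_subset_of_le h hA)
      (fun _ => Finpartition.part_subset_of_le h hB),
      sum_stepFunction Q F (hcell A hA) (hcell B hB)]
  -- On A × B the coarse step function is the constant d, and (a - d)² = a² - d² - 2d(a - d); the
  -- last term sums to zero.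
  have h2 : ∑ u ∈ A, ∑ v ∈ B, (stepFunction Q' F u v - stepFunction Q F u v) * (2 * d) = 0 := by
    simp_rw [← sum_mul, sum_sub_distrib]
    rw [h1, sub_self, zero_mul]
  rw [← sub_eq_zero, ← neg_eq_zero, ← h2]
  simp_rw [← sum_sub_distrib, ← sum_neg_distrib]
  refine sum_congr rfl fun u hu => sum_congr rfl fun v hv => ?_
  rw [stepFunction_eq Q F hA hB hu hv]
  ring

theorem stepEnergy_nonneg (Q : Finpartition (univ : Finset α)) (F : α → α → ℝ) :
    0 ≤ stepEnergy Q F :=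
  sum_nonneg fun _ _ => sum_nonneg fun _ _ => sq_nonneg _

theorem stepEnergy_le (Q : Finpartition (univ : Finset α)) {F : α → α → ℝ}
    (h0 : ∀ u v, 0 ≤ F u v) (h1 : ∀ u v, F u v ≤ 1) :
    stepEnergy Q F ≤ (Fintype.card α : ℝ) ^ 2 := by
  calc stepEnergy Q F ≤ ∑ _u : α, ∑ _v : α, (1 : ℝ) :=
        sum_le_sum fun _ _ => sum_le_sum fun _ _ =>
          pow_le_one₀ (blockDensity_nonneg h0 _ _) (blockDensity_le_one h1 _ _)
    _ = (Fintype.card α : ℝ) ^ 2 := by simp [sq]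

/-- Pythagoras combined with the pointwise bound |x| ≤ η/2 + x²/(2η), which replaces Cauchy–Schwarz.
-/
theorem sum_abs_stepFunction_sub_le {Q Q' : Finpartition (univ : Finset α)} (h : Q' ≤ Q)
    (F : α → α → ℝ) {η : ℝ} (hη : 0 < η) :
    ∑ u, ∑ v, |stepFunction Q' F u v - stepFunction Q F u v| ≤
      η / 2 * (Fintype.card α : ℝ) ^ 2 + (stepEnergy Q' F - stepEnergy Q F) / (2 * η) := by
  have hx : ∀ x : ℝ, |x| ≤ η / 2 + x ^ 2 / (2 * η) := fun x => by
    rw [← sq_abs x]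
    have : η / 2 + |x| ^ 2 / (2 * η) - |x| = (|x| - η) ^ 2 / (2 * η) := by field_simp; ring
    have : 0 ≤ (|x| - η) ^ 2 / (2 * η) := by positivity
    linarith
  rw [← sum_sq_stepFunction_sub h]
  calc _ ≤ ∑ u, ∑ v, (η / 2 + (stepFunction Q' F u v - stepFunction Q F u v) ^ 2 / (2 * η)) :=
        sum_le_sum fun _ _ => sum_le_sum fun _ _ => hx _
    _ = _ := by
        simp_rw [sum_add_distrib, ← sum_div]
        simp
        ring

/-- The sum over a box is unchanged by averaging, up to the elements whose class leaves the box. -/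
theorem abs_sum_sub_stepFunction_le (Q : Finpartition (univ : Finset α)) {F : α → α → ℝ}
    (h0 : ∀ u v, 0 ≤ F u v) (h1 : ∀ u v, F u v ≤ 1) (I J : Finset α) :
    |∑ u ∈ I, ∑ v ∈ J, (F u v - stepFunction Q F u v)| ≤
      #{u ∈ I | ¬ Q.part u ⊆ I} * #J + #I * #{u ∈ J | ¬ Q.part u ⊆ J} := by
  set g : α → α → ℝ := fun u v => F u v - stepFunction Q F u v with hg
  have hg1 : ∀ u v, |g u v| ≤ 1 := fun u v => by
    have a := blockDensity_nonneg h0 (Q.part u) (Q.part v)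
    have b := blockDensity_le_one h1 (Q.part u) (Q.part v)
    have c := h0 u v
    have d := h1 u v
    rw [abs_le]
    constructor <;> simp only [hg, stepFunction] <;> linarith
  have hbox : ∀ S T : Finset α, |∑ u ∈ S, ∑ v ∈ T, g u v| ≤ #S * #T := fun S T => by
    calc _ ≤ ∑ u ∈ S, ∑ v ∈ T, |g u v| :=
          (abs_sum_le_sum_abs _ _).trans (sum_le_sum fun _ _ => abs_sum_le_sum_abs _ _)
      _ ≤ ∑ u ∈ S, ∑ v ∈ T, (1 : ℝ) := sum_le_sum fun _ _ => sum_le_sum fun _ _ => hg1 _ _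
      _ = #S * #T := by simp
  -- The elements of S whose class stays in S form a union of classes, and averaging preserves sums
  -- over products of such sets.
  have hsat : ∀ S : Finset α, ∀ u ∈ ({u ∈ S | Q.part u ⊆ S} : Finset α),
      Q.part u ⊆ ({u ∈ S | Q.part u ⊆ S} : Finset α) := fun S u hu w hw => by
    rw [mem_filter] at hu ⊢
    rw [Q.part_eq_part hw]
    exact ⟨hu.2 hw, hu.2⟩
  have hzero : ∑ u ∈ I with Q.part u ⊆ I, ∑ v ∈ J with Q.part v ⊆ J, g u v = 0 := by
    simp only [hg, sum_sub_distrib]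
    rw [sum_stepFunction Q F (hsat I) (hsat J), sub_self]
  have hsplit : ∑ u ∈ I, ∑ v ∈ J, g u v =
      ∑ u ∈ I with ¬ Q.part u ⊆ I, ∑ v ∈ J, g u v +
        ∑ u ∈ I with Q.part u ⊆ I, ∑ v ∈ J with ¬ Q.part v ⊆ J, g u v := by
    rw [← sum_filter_add_sum_filter_not I (fun u => Q.part u ⊆ I), add_comm]
    congr 1
    rw [← zero_add (∑ u ∈ I with Q.part u ⊆ I, ∑ v ∈ J with ¬ Q.part v ⊆ J, g u v), ← hzero,
      ← sum_add_distrib]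
    exact sum_congr rfl fun u _ => (sum_filter_add_sum_filter_not J _ _).symm
  rw [hsplit]
  refine (abs_add_le _ _).trans (add_le_add (hbox _ _) ((hbox _ _).trans ?_))
  gcongr
  exact filter_subset _ _

/-- The deviation on a sub-box of a pair of classes, estimated through a refinement. -/
theorem card_mul_abs_blockDensity_sub_le {Q Q' : Finpartition (univ : Finset α)}
    {F : α → α → ℝ} (h0 : ∀ u v, 0 ≤ F u v) (h1 : ∀ u v, F u v ≤ 1) {A B I J : Finset α}
    (hA : A ∈ Q.parts) (hB : B ∈ Q.parts) (hIA : I ⊆ A) (hJB : J ⊆ B)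
    (hI : I.Nonempty) (hJ : J.Nonempty) :
    #I * #J * |blockDensity F I J - blockDensity F A B| ≤
      ∑ u ∈ A, ∑ v ∈ B, |stepFunction Q' F u v - stepFunction Q F u v| +
        (#{u ∈ I | ¬ Q'.part u ⊆ I} * #J + #I * #{u ∈ J | ¬ Q'.part u ⊆ J}) := by
  have hpos : (0 : ℝ) ≤ #I * #J := by positivity
  have hconst : ∑ u ∈ I, ∑ v ∈ J, stepFunction Q F u v = #I * #J * blockDensity F A B := by
    rw [sum_congr rfl fun u hu => sum_congr rfl fun v hv =>
      stepFunction_eq Q F hA hB (hIA hu) (hJB hv)]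
    simp [mul_assoc]
  have hkey : #I * #J * (blockDensity F I J - blockDensity F A B) =
      ∑ u ∈ I, ∑ v ∈ J, (F u v - stepFunction Q' F u v) +
        ∑ u ∈ I, ∑ v ∈ J, (stepFunction Q' F u v - stepFunction Q F u v) := by
    rw [mul_sub, card_mul_blockDensity F hI hJ, ← hconst]
    simp only [sum_sub_distrib]
    ring
  rw [← abs_of_nonneg hpos, ← abs_mul, hkey, add_comm (∑ u ∈ A, _)]
  refine (abs_add_le _ _).trans (add_le_add (abs_sum_sub_stepFunction_le Q' h0 h1 I J) ?_)
  calc _ ≤ ∑ u ∈ I, ∑ v ∈ J, |stepFunction Q' F u v - stepFunction Q F u v| :=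
        (abs_sum_le_sum_abs _ _).trans (sum_le_sum fun _ _ => abs_sum_le_sum_abs _ _)
    _ ≤ ∑ u ∈ I, ∑ v ∈ B, |stepFunction Q' F u v - stepFunction Q F u v| :=
        sum_le_sum fun _ _ => sum_le_sum_of_subset_of_nonneg hJB fun _ _ _ => abs_nonneg _
    _ ≤ _ := sum_le_sum_of_subset_of_nonneg hIA fun _ _ _ => sum_nonneg fun _ _ => abs_nonneg _

end StepFunction

/-! ### Chopping intervals into equal pieces -/

section Chop

variable {n : ℕ}

/-- The number of smaller elements in the same class. -/
def partRank (Q : Finpartition (univ : Finset (Fin n))) (u : Fin n) : ℕ :=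
  #{w ∈ Q.part u | w < u}

open Classical in
/-- Chop every class of `Q` into consecutive pieces of size `m` and one smaller piece. -/
noncomputable def chop (Q : Finpartition (univ : Finset (Fin n))) (m : ℕ) :
    Finpartition (univ : Finset (Fin n)) :=
  Finpartition.ofSetoid (Setoid.ker fun u => (Q.part u, partRank Q u / m))

theorem mem_part_chop (Q : Finpartition (univ : Finset (Fin n))) (m : ℕ) {u v : Fin n} :
    v ∈ (chop Q m).part u ↔ Q.part u = Q.part v ∧ partRank Q u / m = partRank Q v / m := by
  classical
  rw [chop, Finpartition.mem_part_ofSetoid_iff_rel, Setoid.ker_def, Prod.mk.injEq]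

theorem part_chop_subset (Q : Finpartition (univ : Finset (Fin n))) (m : ℕ) (u : Fin n) :
    (chop Q m).part u ⊆ Q.part u := fun v hv => by
  rw [((mem_part_chop Q m).1 hv).1]
  exact Q.mem_part (mem_univ v)

theorem Finpartition.exists_part_eq {α : Type*} [Fintype α] [DecidableEq α]
    (Q : Finpartition (univ : Finset α)) {A : Finset α}
    (hA : A ∈ Q.parts) : ∃ u, Q.part u = A := by
  obtain ⟨u, hu⟩ := Q.nonempty_of_mem_parts hA
  exact ⟨u, Q.part_eq_of_mem hA hu⟩

theorem chop_le (Q : Finpartition (univ : Finset (Fin n))) (m : ℕ) : chop Q m ≤ Q := by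
  intro C hC
  obtain ⟨u, rfl⟩ := (chop Q m).exists_part_eq hC
  exact ⟨Q.part u, Q.part_mem.2 (mem_univ u), part_chop_subset Q m u⟩

theorem partRank_le (Q : Finpartition (univ : Finset (Fin n))) {u v : Fin n}
    (h : Q.part u = Q.part v) (huv : u ≤ v) : partRank Q u ≤ partRank Q v := by
  rw [partRank, partRank, h]
  exact card_le_card (monotone_filter_right _ fun w _ hw => lt_of_lt_of_le hw huv)

theorem partRank_lt (Q : Finpartition (univ : Finset (Fin n))) {u v : Fin n}
    (h : Q.part u = Q.part v) (huv : u < v) : partRank Q u < partRank Q v := by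
  rw [partRank, partRank, h]
  refine card_lt_card ((ssubset_iff_of_subset
    (monotone_filter_right _ fun w _ hw => lt_trans hw huv)).2 ⟨u, ?_, ?_⟩)
  · rw [mem_filter, ← h]
    exact ⟨Q.mem_part (mem_univ u), huv⟩
  · simp

theorem partRank_lt_card (Q : Finpartition (univ : Finset (Fin n))) (u : Fin n) :
    partRank Q u < #(Q.part u) := by
  refine card_lt_card ((ssubset_iff_of_subset (filter_subset _ _)).2 ⟨u, ?_, ?_⟩)
  · exact Q.mem_part (mem_univ u)
  · simp

theorem injOn_partRank (Q : Finpartition (univ : Finset (Fin n))) (u : Fin n) :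
    Set.InjOn (partRank Q) (Q.part u) := by
  intro x hx y hy hxy
  have h : Q.part x = Q.part y := (Q.part_eq_part hx).trans (Q.part_eq_part hy).symm
  rcases lt_trichotomy x y with hlt | heq | hlt
  · exact absurd hxy (partRank_lt Q h hlt).ne
  · exact heq
  · exact absurd hxy (partRank_lt Q h.symm hlt).ne'

theorem image_partRank (Q : Finpartition (univ : Finset (Fin n))) (u : Fin n) :
    (Q.part u).image (partRank Q) = range #(Q.part u) := by
  refine eq_of_subset_of_card_le (fun r hr => ?_) ?_
  · obtain ⟨x, hx, rfl⟩ := mem_image.1 hr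
    rw [mem_range, ← Q.part_eq_part hx]
    exact partRank_lt_card Q x
  · rw [card_range, card_image_of_injOn (injOn_partRank Q u)]

theorem isIntervalPartition_chop {Q : Finpartition (univ : Finset (Fin n))}
    (hQ : IsIntervalPartition Q) (m : ℕ) : IsIntervalPartition (chop Q m) := by
  intro C hC
  refine ⟨(chop Q m).nonempty_of_mem_parts hC, ⟨?_⟩⟩
  obtain ⟨u, rfl⟩ := (chop Q m).exists_part_eq hC
  intro x hx z hz y hy
  have hyQ : y ∈ Q.part u := by
    exact_mod_cast (hQ _ (Q.part_mem.2 (mem_univ u))).2.out (part_chop_subset Q m u hx)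
      (part_chop_subset Q m u hz) hy
  rw [mem_coe, mem_part_chop] at hx hz ⊢
  have hu := Q.part_eq_part hyQ
  refine ⟨hu.symm, le_antisymm ?_ ?_⟩
  · rw [hx.2]
    exact Nat.div_le_div_right (partRank_le Q (hx.1.symm.trans hu.symm) hy.1)
  · rw [hz.2]
    exact Nat.div_le_div_right (partRank_le Q (hu.trans hz.1) hy.2)

theorem card_part_chop_le (Q : Finpartition (univ : Finset (Fin n))) {m : ℕ} (hm : 0 < m)
    (u : Fin n) : #((chop Q m).part u) ≤ m := by
  calc #((chop Q m).part u)
      ≤ #(Ico (partRank Q u / m * m) (partRank Q u / m * m + m)) := by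
        refine card_le_card_of_injOn (partRank Q) (fun v hv => ?_)
          ((injOn_partRank Q u).mono (part_chop_subset Q m u))
        rw [mem_coe, mem_part_chop] at hv
        rw [hv.2, mem_coe, mem_Ico]
        exact ⟨Nat.div_mul_le_self _ _, Nat.lt_div_mul_add hm⟩
    _ = m := by simp

/-- The ranks in a class fill an initial segment of ℕ, so a window of m consecutive ranks that ends
within the class is fully occupied. -/
theorem card_part_chop_eq (Q : Finpartition (univ : Finset (Fin n))) {m : ℕ} (hm : 0 < m)
    {u : Fin n} (hu : partRank Q u / m * m + m ≤ #(Q.part u)) : #((chop Q m).part u) = m := by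
  refine le_antisymm (card_part_chop_le Q hm u) ?_
  calc m = #(Ico (partRank Q u / m * m) (partRank Q u / m * m + m)) := by simp
    _ ≤ #(((chop Q m).part u).image (partRank Q)) := by
        refine card_le_card fun r hr => ?_
        rw [mem_Ico] at hr
        have hr' : r ∈ (Q.part u).image (partRank Q) := by
          rw [image_partRank, mem_range]
          omega
        obtain ⟨v, hv, rfl⟩ := mem_image.1 hr'
        refine mem_image_of_mem _ ((mem_part_chop Q m).2 ⟨(Q.part_eq_part hv).symm, ?_⟩)
        refine (Nat.div_eq_of_lt_le hr.1 ?_).symm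
        rw [add_mul, one_mul]
        exact hr.2
    _ ≤ _ := card_image_le

/-- Only the last, incomplete window of ranks of a class can give a piece of the wrong size. -/
theorem card_filter_part_chop_ne_le (Q : Finpartition (univ : Finset (Fin n))) {m : ℕ}
    (hm : 0 < m) {A : Finset (Fin n)} (hA : A ∈ Q.parts) :
    #{u ∈ A | #((chop Q m).part u) ≠ m} ≤ m := by
  obtain ⟨x, rfl⟩ := Q.exists_part_eq hA
  set a := #(Q.part x) with ha
  calc #{u ∈ Q.part x | #((chop Q m).part u) ≠ m} ≤ #(Ico (a / m * m) a) := by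
        refine card_le_card_of_injOn (partRank Q) (fun u hu => ?_)
          ((injOn_partRank Q x).mono fun u hu => (mem_filter.1 hu).1)
        rw [mem_coe, mem_filter] at hu
        have hux := Q.part_eq_part hu.1
        have h1 : a < partRank Q u / m * m + m := by
          by_contra h
          refine hu.2 (card_part_chop_eq Q hm ?_)
          rw [hux]
          exact not_lt.1 h
        have h2 : partRank Q u < a := by
          rw [ha, ← hux]
          exact partRank_lt_card Q u
        rw [mem_coe, mem_Ico]
        refine ⟨?_, h2⟩
        have h3 : a / m ≤ partRank Q u / m := by
          refine Nat.lt_succ_iff.1 ((Nat.div_lt_iff_lt_mul hm).2 ?_)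
          rwa [Nat.succ_mul]
        exact (Nat.mul_le_mul_right m h3).trans (Nat.div_mul_le_self _ _)
    _ ≤ m := by
        rw [Nat.card_Ico]
        have := Nat.lt_div_mul_add (a := a) hm
        omega

theorem isEpsBalanced_chop (Q : Finpartition (univ : Finset (Fin n))) {m : ℕ} (hm : 0 < m)
    {ε : ℝ} (h : (#Q.parts * m : ℝ) ≤ ε * n) : IsEpsBalanced ε (chop Q m) := by
  refine ⟨{C ∈ (chop Q m).parts | #C ≠ m}, filter_subset _ _, ?_, le_trans ?_ h⟩
  · have : ∀ C ∈ (chop Q m).parts \ {C ∈ (chop Q m).parts | #C ≠ m}, #C = m := fun C hC => by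
      by_contra hne
      rw [mem_sdiff] at hC
      exact hC.2 (mem_filter.2 ⟨hC.1, hne⟩)
    intro A hA B hB
    rw [this A hA, this B hB]
  · norm_cast
    calc _ ≤ #(Q.parts.biUnion fun A => {u ∈ A | #((chop Q m).part u) ≠ m}) := by
          refine card_le_card fun u hu => ?_
          obtain ⟨C, hC, huC⟩ := mem_biUnion.1 hu
          rw [mem_filter] at hC
          refine mem_biUnion.2 ⟨Q.part u, Q.part_mem.2 (mem_univ u), mem_filter.2
            ⟨Q.mem_part (mem_univ u), ?_⟩⟩
          rw [(chop Q m).part_eq_of_mem hC.1 huC]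
          exact hC.2
      _ ≤ #Q.parts * m := card_biUnion_le_card_mul _ _ _ fun A hA =>
          card_filter_part_chop_ne_le Q hm hA

theorem card_parts_chop_le (Q : Finpartition (univ : Finset (Fin n))) (m : ℕ) :
    #(chop Q m).parts ≤ #Q.parts * (n / m + 1) := by
  calc #(chop Q m).parts ≤ #((Q.parts ×ˢ range (n / m + 1)).image
        fun q => ({u ∈ q.1 | partRank Q u / m = q.2} : Finset (Fin n))) := by
        refine card_le_card fun C hC => ?_
        obtain ⟨x, rfl⟩ := (chop Q m).exists_part_eq hC
        refine mem_image.2 ⟨(Q.part x, partRank Q x / m), mem_product.2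
          ⟨Q.part_mem.2 (mem_univ x), mem_range.2 (Nat.lt_succ_of_le (Nat.div_le_div_right ?_))⟩,
          ?_⟩
        · refine (partRank_lt_card Q x).le.trans ?_
          simpa using card_le_univ (Q.part x)
        · ext u
          rw [mem_filter, mem_part_chop,
            Q.mem_part_iff_part_eq_part (mem_univ _) (mem_univ _), eq_comm,
            eq_comm (a := partRank Q u / m)]
    _ ≤ _ := by
        refine card_image_le.trans ?_
        rw [card_product, card_range]

/-- In an interval, only the classes of its end points can leave it. -/
theorem card_filter_not_part_subset_le {Q : Finpartition (univ : Finset (Fin n))}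
    (hQ : IsIntervalPartition Q) {m : ℕ} (hm : ∀ u, #(Q.part u) ≤ m) {I : Finset (Fin n)}
    (hI : IsVertexInterval I) : #{u ∈ I | ¬ Q.part u ⊆ I} ≤ 2 * m := by
  calc _ ≤ #(Q.part (I.min' hI.1) ∪ Q.part (I.max' hI.1)) := by
        refine card_le_card fun u hu => ?_
        rw [mem_filter, not_subset] at hu
        obtain ⟨huI, w, hw, hwI⟩ := hu
        have hc := (hQ _ (Q.part_mem.2 (mem_univ u))).2
        have huu : u ∈ Q.part u := Q.mem_part (mem_univ u)
        rw [mem_union, Q.mem_part_comm, Q.mem_part_comm (u := u) (v := I.max' hI.1)]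
        -- The class of u is an interval reaching a point w outside I, so it passes over an end
        -- point of I.
        by_cases h1 : w < I.min' hI.1
        · left
          exact_mod_cast hc.out hw huu ⟨h1.le, I.min'_le u huI⟩
        · right
          refine mod_cast hc.out huu hw ⟨I.le_max' u huI, le_of_not_gt fun h2 => hwI ?_⟩
          exact_mod_cast hI.2.out (I.min'_mem hI.1) (I.max'_mem hI.1) ⟨not_lt.1 h1, h2.le⟩
    _ ≤ _ := by
        refine (card_union_le _ _).trans ?_
        rw [two_mul]
        exact add_le_add (hm _) (hm _)

end Chop

/-! ### Deviations on intervals and iterated chopping -/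

section Regularity

variable {n : ℕ}

theorem edgeDensity_eq_blockDensity (G : SimpleGraph (Fin n)) [DecidableRel G.Adj]
    (A B : Finset (Fin n)) :
    (G.edgeDensity A B : ℝ) = blockDensity (fun u v => if G.Adj u v then 1 else 0) A B := by
  rw [SimpleGraph.edgeDensity, Rel.edgeDensity, Rel.interedges, blockDensity]
  push_cast
  rw [card_filter, sum_product]
  push_cast
  rfl

theorem sum_maxIntervalDeviation_le (G : SimpleGraph (Fin n)) [DecidableRel G.Adj]
    {Q Q' : Finpartition (univ : Finset (Fin n))} (hQ' : IsIntervalPartition Q')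
    {m : ℕ} (hm : ∀ u, #(Q'.part u) ≤ m) :
    ∑ A ∈ Q.parts, ∑ B ∈ Q.parts, maxIntervalDeviation G A B ≤
      ∑ u, ∑ v, |stepFunction Q' (fun u v => if G.Adj u v then 1 else 0) u v -
        stepFunction Q (fun u v => if G.Adj u v then 1 else 0) u v| + 4 * (#Q.parts * m) * n := by
  set F : Fin n → Fin n → ℝ := fun u v => if G.Adj u v then 1 else 0 with hF
  have h0 : ∀ u v, 0 ≤ F u v := fun u v => by
    simp only [hF]
    split_ifs <;> norm_num
  have h1 : ∀ u v, F u v ≤ 1 := fun u v => by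
    simp only [hF]
    split_ifs <;> norm_num
  calc _ ≤ ∑ A ∈ Q.parts, ∑ B ∈ Q.parts,
          (∑ u ∈ A, ∑ v ∈ B, |stepFunction Q' F u v - stepFunction Q F u v| +
            (2 * m * #B + #A * (2 * m))) := by
        refine sum_le_sum fun A hA => sum_le_sum fun B hB => Real.sSup_le ?_ ?_
        · rintro x ⟨I, J, hIA, hJB, hI, hJ, rfl⟩
          rw [edgeDensity_eq_blockDensity, edgeDensity_eq_blockDensity]
          refine (card_mul_abs_blockDensity_sub_le (Q' := Q') h0 h1 hA hB hIA hJB hI.1 hJ.1).trans ?_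
          have hIm : (#{u ∈ I | ¬ Q'.part u ⊆ I} : ℝ) ≤ 2 * m := mod_cast
            card_filter_not_part_subset_le hQ' hm hI
          have hJm : (#{u ∈ J | ¬ Q'.part u ⊆ J} : ℝ) ≤ 2 * m := mod_cast
            card_filter_not_part_subset_le hQ' hm hJ
          gcongr
        -- `Real.sSup_le` also asks for a nonnegative bound, since the supremum of the empty set is
        -- 0.
        · exact add_nonneg (sum_nonneg fun _ _ => sum_nonneg fun _ _ => abs_nonneg _)
            (by positivity)
    _ = _ := by
        simp only [sum_add_distrib, sum_const, nsmul_eq_mul, ← mul_sum, ← sum_mul,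
          Q.sum_parts_sum_sum, Q.sum_parts_card, Fintype.card_fin]
        ring

theorem maxIntervalDeviation_singleton (G : SimpleGraph (Fin n)) [DecidableRel G.Adj]
    (a b : Fin n) : maxIntervalDeviation G {a} {b} = 0 := by
  obtain ⟨I, J, hI, hJ, hI', hJ', h⟩ :=
    (isGreatest_maxIntervalDeviation G (singleton_nonempty a) (singleton_nonempty b)).1
  rw [h, hI'.1.subset_singleton_iff.1 hI, hJ'.1.subset_singleton_iff.1 hJ, sub_self, abs_zero,
    mul_zero]

/-- The bounds for the number of classes under iterated chopping. -/
def chopBound (D p : ℕ) : ℕ → ℕ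
  | 0 => p + 1
  | t + 1 => chopBound D p t * (2 * D * chopBound D p t + 1)

theorem chopBound_pos (D p t : ℕ) : 0 < chopBound D p t := by
  induction t with
  | zero => exact Nat.succ_pos p
  | succ t ih => exact Nat.mul_pos ih (Nat.succ_pos _)

theorem monotone_chopBound (D p : ℕ) : Monotone (chopBound D p) :=
  monotone_nat_of_le_succ fun _ => Nat.le_mul_of_pos_right _ (Nat.succ_pos _)

/-- Iterated chopping into pieces whose size is adapted to `chopBound`. -/
noncomputable def chopIter (D p : ℕ) (P : Finpartition (univ : Finset (Fin n))) :
    ℕ → Finpartition (univ : Finset (Fin n))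
  | 0 => P
  | t + 1 => chop (chopIter D p P t) (n / (D * chopBound D p t))

variable {D p : ℕ} {P : Finpartition (univ : Finset (Fin n))}

theorem chopIter_le (D p : ℕ) (P : Finpartition (univ : Finset (Fin n))) (t : ℕ) :
    chopIter D p P t ≤ P := by
  induction t with
  | zero => exact le_refl P
  | succ t ih => exact (chop_le _ _).trans ih

theorem isIntervalPartition_chopIter (hP : IsIntervalPartition P) (D p t : ℕ) :
    IsIntervalPartition (chopIter D p P t) := by
  induction t with
  | zero => exact hP
  | succ t ih => exact isIntervalPartition_chop ih _

theorem chopSize_pos (hD : 0 < D) {T t : ℕ} (hn : D * chopBound D p T ≤ n) (ht : t ≤ T) :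
    0 < n / (D * chopBound D p t) :=
  Nat.div_pos ((Nat.mul_le_mul_left D (monotone_chopBound D p ht)).trans hn)
    (Nat.mul_pos hD (chopBound_pos D p t))

theorem card_parts_chopIter_le (hD : 0 < D) {T : ℕ} (hn : D * chopBound D p T ≤ n)
    (hPp : #P.parts ≤ p) {t : ℕ} (ht : t ≤ T) :
    #(chopIter D p P t).parts ≤ chopBound D p t := by
  induction t with
  | zero => exact hPp.trans (Nat.le_succ p)
  | succ t ih =>
    refine (card_parts_chop_le _ _).trans (Nat.mul_le_mul (ih (by omega)) (Nat.succ_le_succ ?_))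
    have hm := chopSize_pos hD hn (show t ≤ T by omega)
    set k := chopBound D p t with hk
    have hDk : 0 < D * k := Nat.mul_pos hD (chopBound_pos D p t)
    -- As m ≥ 1, rounding down loses at most a factor 2: n < (m + 1)Dk ≤ 2Dkm. This is the 2 in
    -- `chopBound`.
    have h := Nat.lt_div_mul_add (a := n) hDk
    set m := n / (D * k)
    refine Nat.le_of_lt_succ ((Nat.div_lt_iff_lt_mul hm).2 ?_)
    nlinarith

/-- The next piece size times the current number of classes bounds both the vertices in short pieces
and the boundary errors. -/
theorem card_parts_chopIter_mul_le (hD : 0 < D) {T : ℕ} (hn : D * chopBound D p T ≤ n)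
    (hPp : #P.parts ≤ p) {t : ℕ} (ht : t ≤ T) :
    (#(chopIter D p P t).parts * (n / (D * chopBound D p t) : ℕ) : ℝ) ≤ n / D := by
  rw [le_div_iff₀ (by exact_mod_cast hD)]
  norm_cast
  calc _ ≤ chopBound D p t * (n / (D * chopBound D p t)) * D :=
        Nat.mul_le_mul_right D (Nat.mul_le_mul_right _ (card_parts_chopIter_le hD hn hPp ht))
    _ = n / (D * chopBound D p t) * (D * chopBound D p t) := by ring
    _ ≤ n := Nat.div_mul_le_self _ _

end Regularity

/-! ### Choice of constants and the energy pigeonhole -/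

theorem mainTheorem3 (ε : ℝ) (hε : 0 < ε) (p : ℕ) :
    ∃ k : ℕ, ∀ n : ℕ, 0 < n → ∀ (G : SimpleGraph (Fin n)) [DecidableRel G.Adj]
      (P : Finpartition (Finset.univ : Finset (Fin n))),
      IsIntervalPartition P → P.parts.card ≤ p →
      ∃ Q : Finpartition (Finset.univ : Finset (Fin n)),
        Q ≤ P ∧ IsIntervalPartition Q ∧ Q.parts.card ≤ k ∧ IsEpsBalanced ε Q ∧
        ∑ A ∈ Q.parts, ∑ B ∈ Q.parts, maxIntervalDeviation G A B < ε * (n : ℝ) ^ 2 := by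
  -- The deviation sum gets ε/4 · n² from each of three sources: the boundary error 4 · n/D · n, the
  -- term η/2 · n² with η = ε/2, and the energy term n²/(Tε).
  obtain ⟨D, hD⟩ := exists_nat_gt (16 / ε)
  obtain ⟨T, hT⟩ := exists_nat_gt (4 / ε ^ 2)
  have hD0 : (0 : ℝ) < D := lt_trans (by positivity) hD
  have hT0 : (0 : ℝ) < T := lt_trans (by positivity) hT
  have hDpos : 0 < D := by exact_mod_cast hD0
  have hTpos : 0 < T := by exact_mod_cast hT0
  refine ⟨D * chopBound D p (T + 1), fun n hn0 G _ P hP hPp => ?_⟩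
  have hnR : (0 : ℝ) < n := by exact_mod_cast hn0
  rcases lt_or_ge n (D * chopBound D p (T + 1)) with hn | hn
  -- For small n the partition into singletons has few enough classes and no deviation.
  · have hbot : ∀ A ∈ (⊥ : Finpartition (univ : Finset (Fin n))).parts, ∃ a, A = {a} :=
      fun A hA => by
        obtain ⟨a, -, rfl⟩ := Finpartition.mem_bot_iff.1 hA
        exact ⟨a, rfl⟩
    refine ⟨⊥, bot_le, fun A hA => ?_, ?_, ⟨∅, empty_subset _, fun A hA B hB => ?_, ?_⟩, ?_⟩
    · obtain ⟨a, rfl⟩ := hbot A hA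
      refine ⟨singleton_nonempty a, ?_⟩
      rw [coe_singleton]
      exact Set.ordConnected_singleton
    · rw [Finpartition.card_bot, card_univ, Fintype.card_fin]
      exact hn.le
    · obtain ⟨a, rfl⟩ := hbot A (mem_sdiff.1 hA).1
      obtain ⟨b, rfl⟩ := hbot B (mem_sdiff.1 hB).1
      rw [card_singleton, card_singleton]
    · rw [biUnion_empty, card_empty, Nat.cast_zero]
      positivity
    · rw [sum_eq_zero fun A hA => sum_eq_zero fun B hB => ?_]
      · positivity
      · obtain ⟨a, rfl⟩ := hbot A hA
        obtain ⟨b, rfl⟩ := hbot B hB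
        exact maxIntervalDeviation_singleton G a b
  set F : Fin n → Fin n → ℝ := fun u v => if G.Adj u v then 1 else 0 with hF
  have h0 : ∀ u v, 0 ≤ F u v := fun u v => by
    simp only [hF]
    split_ifs <;> norm_num
  have h1 : ∀ u v, F u v ≤ 1 := fun u v => by
    simp only [hF]
    split_ifs <;> norm_num
  have hinv : (n : ℝ) / D ≤ ε / 16 * n := by
    rw [div_lt_iff₀ hε] at hD
    rw [div_le_iff₀ hD0]
    nlinarith
  -- T increments share a total of at most n². Indices start at 1, because P itself need not be
  -- balanced while every later partition is a chop.
  obtain ⟨t, ht, hE⟩ : ∃ t ∈ range T, stepEnergy (chopIter D p P (t + 1 + 1)) F -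
      stepEnergy (chopIter D p P (t + 1)) F ≤ (n : ℝ) ^ 2 / T := by
    refine exists_le_of_sum_le (nonempty_range_iff.2 hTpos.ne') ?_
    rw [sum_range_sub (fun t => stepEnergy (chopIter D p P (t + 1)) F), sum_const, card_range,
      nsmul_eq_mul, mul_div_cancel₀ _ hT0.ne']
    have hle := stepEnergy_le (chopIter D p P (T + 1)) h0 h1
    have hge := stepEnergy_nonneg (chopIter D p P (0 + 1)) F
    rw [Fintype.card_fin] at hle
    linarith
  rw [mem_range] at ht
  have htT : t + 1 ≤ T + 1 := by omega
  refine ⟨chopIter D p P (t + 1), chopIter_le D p P _, isIntervalPartition_chopIter hP D p _,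
    ?_, ?_, ?_⟩
  · calc _ ≤ chopBound D p (t + 1) := card_parts_chopIter_le hDpos hn hPp htT
      _ ≤ chopBound D p (T + 1) := monotone_chopBound D p htT
      _ ≤ _ := Nat.le_mul_of_pos_left _ hDpos
  · refine isEpsBalanced_chop _ (chopSize_pos hDpos hn (by omega)) ?_
    refine (card_parts_chopIter_mul_le hDpos hn hPp (by omega)).trans (hinv.trans ?_)
    nlinarith [mul_pos hε hnR]
  · have hdev := sum_maxIntervalDeviation_le G (Q := chopIter D p P (t + 1))
      (isIntervalPartition_chopIter hP D p (t + 1 + 1))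
      (card_part_chop_le _ (chopSize_pos hDpos hn htT))
    have hstep := sum_abs_stepFunction_sub_le (Q' := chopIter D p P (t + 1 + 1))
      (chop_le (chopIter D p P (t + 1)) (n / (D * chopBound D p (t + 1)))) F (half_pos hε)
    have hbd := (card_parts_chopIter_mul_le hDpos hn hPp htT).trans hinv
    rw [Fintype.card_fin] at hstep
    have hE' : (stepEnergy (chopIter D p P (t + 1 + 1)) F -
        stepEnergy (chopIter D p P (t + 1)) F) / (2 * (ε / 2)) ≤ ε / 4 * (n : ℝ) ^ 2 := by
      rw [div_le_iff₀ (by positivity)]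
      refine hE.trans ?_
      rw [div_le_iff₀ hT0]
      rw [div_lt_iff₀ (by positivity)] at hT
      nlinarith [sq_nonneg (n : ℝ)]
    have hbd' := mul_le_mul_of_nonneg_right hbd hnR.le
    have hpos : 0 < ε * (n : ℝ) ^ 2 := by positivity
    rw [← hF] at hdev
    linarith
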